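/- Let $\{Z(n), n\ge 0\}$ be a Galton--Watson branching process with $Z(0)=1$ and offspring number $\xi$ taking values in $\{0,1,2,\dots\}$, let $f(s)=\mathbf{E}s^{\xi}$, $0\le s\le 1$, and let $f_0(s)=s$, $f_n(s)=f(f_{n-1}(s))$ for $n\ge 1$ be the iterates of $f$. Assume that, for some $\alpha\in(0,1)$, $$\mathbf{E}\xi=1,\qquad f(s)=s+(1-s)^{1+\alpha}L(1-s),\quad 0\le s\le 1,$$ where $L$ is slowly varying at zero, that is, $L(z)>0$ for all sufficiently small $z>0$ and $L(yz)/L(z)\to 1$ as $z\downarrow 0$ for every $y>0$. Let $\varphi(n)$, $n=1,2,\dots$, be a deterministic real sequence such that $\varphi(n)\to\infty$ and $\varphi(n)/n\to 0$ as $n\to\infty$, and read $f_{\varphi(n)}$ as $f_{\lfloor\varphi(n)\rfloor}$ when $\varphi(n)$ is not an integer. Then, as $n\to\infty$, $$\mathbf{P}\bigl(0<(1-f_{\varphi(n)}(0))\,Z(n)\le 1\bigr)\sim\frac{1-f_n(0)}{\alpha n}\,\frac{1}{\Gamma(1+\alpha)}\,\varphi(n),$$ where $\Gamma$ is the Gamma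 function and $a_n\sim b_n$ means $a_n/b_n\to 1$. -/

import Mathlib

open MeasureTheory ProbabilityTheory Filter Topology Asymptotics

/-- The probability generating function `s ↦ ∑ k, ν {k} s ^ k` of a law `ν` on `ℕ`. -/
noncomputable def pgf (ν : Measure ℕ) (s : ℝ) : ℝ := ∫ k, s ^ k ∂ν

/-- `L` is slowly varying at `0` from the right. -/
def SlowlyVaryingAtZero (L : ℝ → ℝ) : Prop :=
  (∀ᶠ z in 𝓝[>] (0 : ℝ), 0 < L z) ∧
    ∀ y : ℝ, 0 < y → Tendsto (fun z => L (y * z) / L z) (𝓝[>] 0) (𝓝 1)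

/-- The branching process started from one particle, where `ξ n i` is the number of children of
the `i`-th particle of generation `n`. -/
def branching {Ω : Type*} (ξ : ℕ → ℕ → Ω → ℕ) : ℕ → Ω → ℕ
  | 0 => fun _ => 1
  | n + 1 => fun ω => ∑ i ∈ Finset.range (branching ξ n ω), ξ n i ω

/-- `Z` is a Galton-Watson process on `(Ω, P)` with offspring law `ν` and a single founding
ancestor: it is the branching process of an array of independent offspring numbers of law `ν`. -/
def IsGaltonWatson {Ω : Type*} [MeasurableSpace Ω] (Z : ℕ → Ω → ℕ) (ν : Measure ℕ)
    (P : Measure Ω) : Prop :=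
  ∃ ξ : ℕ → ℕ → Ω → ℕ,
    (∀ n i, HasLaw (ξ n i) ν P) ∧
    iIndepFun (fun (k : ℕ × ℕ) => ξ k.1 k.2) P ∧
    ∀ n, Z n =ᵐ[P] branching ξ n

/-!
The map `F x = 1 - f (1 - x)` is concave, has a parabolic fixed point at `0`, and its orbit of `1`
is the sequence of survival probabilities `e n = 1 - f_n(0)`. Its relative decrement
`h x = (x - F x) / x` is increasing and regularly varying with index `α`, and a monotone density
argument gives `1 / h (F x) - 1 / h x → α`, hence `n * h (e n) → 1 / α`. Two consequences follow:
the orbit of `1` passes `u = 1 - exp (-c * e (φ n)) ∼ c * e (φ n)` after about `c ^ (-α) * φ n`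
steps, and `k = o(n)` further steps decrease `e n` by about `k * e n / (α * n)`. Therefore
`E exp (-c * e (φ n) * Z n) - P (Z n = 0) = e n - F^[n] u ∼ c ^ (-α) * φ n * e n / (α * n)`.
So the law of `e (φ n) * Z n` on `Z n > 0`, multiplied by `α * n / (e n * φ n)`, has a Laplace
transform converging to `c ^ (-α)`, which is that of the infinite measure with density
`x ^ (α - 1) / Γ(α)`. The continuity theorem for Laplace transforms then gives convergence of the
mass of `(0, 1]`.
-/

section RegularVariation

open Set

/-- `h` is regularly varying at `0` from the right with index `ρ`. -/
def RegularlyVaryingAtZero (h : ℝ → ℝ) (ρ : ℝ) : Prop :=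
  ∀ c : ℝ, 0 < c → Tendsto (fun x => h (c * x) / h x) (𝓝[>] 0) (𝓝 (c ^ ρ))

theorem tendsto_of_eventually_le_of_eventually_ge {ι R D : Type*} [LinearOrder R]
    [TopologicalSpace R] [OrderTopology R] [TopologicalSpace D] [Preorder D] {l : Filter ι}
    {F : ι → R} {G : D → ι → R} {γ : D → R} {d₀ : D} [(𝓝[<] d₀).NeBot] [(𝓝[>] d₀).NeBot] {A : R}
    (hγ : Tendsto γ (𝓝[≠] d₀) (𝓝 A)) (hG : ∀ᶠ d in 𝓝[≠] d₀, Tendsto (G d) l (𝓝 (γ d)))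
    (hlower : ∀ᶠ d in 𝓝[<] d₀, ∀ᶠ i in l, G d i ≤ F i)
    (hupper : ∀ᶠ d in 𝓝[>] d₀, ∀ᶠ i in l, F i ≤ G d i) : Tendsto F l (𝓝 A) := by
  refine tendsto_order.2 ⟨fun y hy => ?_, fun y hy => ?_⟩
  · obtain ⟨d, ⟨hyd, hGd⟩, hle⟩ :=
      (((hγ.eventually_const_lt hy).and hG).filter_mono (nhdsLT_le_nhdsNE d₀) |>.and hlower).exists
    filter_upwards [hGd.eventually_const_lt hyd, hle] with i h₁ h₂ using h₁.trans_le h₂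
  · obtain ⟨d, ⟨hyd, hGd⟩, hle⟩ :=
      (((hγ.eventually_lt_const hy).and hG).filter_mono (nhdsGT_le_nhdsNE d₀) |>.and hupper).exists
    filter_upwards [hGd.eventually_lt_const hyd, hle] with i h₁ h₂ using h₂.trans_lt h₁

theorem tendsto_const_mul_nhdsGT_zero {c : ℝ} (hc : 0 < c) :
    Tendsto (fun x => c * x) (𝓝[>] 0) (𝓝[>] 0) := by
  simpa using TendstoNhdsWithinIoi.const_mul hc (tendsto_id (x := 𝓝[>] (0 : ℝ)))

theorem SlowlyVaryingAtZero.regularlyVaryingAtZero_rpow_mul {L : ℝ → ℝ}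
    (hL : SlowlyVaryingAtZero L) (ρ : ℝ) : RegularlyVaryingAtZero (fun x => x ^ ρ * L x) ρ := by
  intro c hc
  have h := (hL.2 c hc).const_mul (c ^ ρ)
  rw [mul_one] at h
  refine h.congr' ?_
  filter_upwards [self_mem_nhdsWithin] with x (hx : 0 < x)
  have : x ^ ρ ≠ 0 := (Real.rpow_pos_of_pos hx _).ne'
  rw [Real.mul_rpow hc.le hx.le]
  field_simp

theorem RegularlyVaryingAtZero.congr {g h : ℝ → ℝ} {ρ : ℝ} (hg : RegularlyVaryingAtZero g ρ)
    (hgh : g =ᶠ[𝓝[>] 0] h) : RegularlyVaryingAtZero h ρ := by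
  intro c hc
  refine (hg c hc).congr' ?_
  filter_upwards [hgh, (tendsto_const_mul_nhdsGT_zero hc).eventually hgh] with x h₁ h₂
  rw [h₁, h₂]

theorem RegularlyVaryingAtZero.div_id {g : ℝ → ℝ} {ρ : ℝ} (hg : RegularlyVaryingAtZero g ρ) :
    RegularlyVaryingAtZero (fun x => g x / x) (ρ - 1) := by
  intro c hc
  rw [Real.rpow_sub_one hc.ne']
  refine ((hg c hc).div_const c).congr' ?_
  filter_upwards [self_mem_nhdsWithin] with x (hx : 0 < x)
  field_simp

theorem eventually_comp_le_comp_of_monotoneOn {ι : Type*} {l : Filter ι} {h : ℝ → ℝ} {δ : ℝ}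
    {u v : ι → ℝ} (hmono : MonotoneOn h (Ioc 0 δ)) (hδ : 0 < δ) (hu : Tendsto u l (𝓝[>] 0))
    (hv : Tendsto v l (𝓝[>] 0)) (huv : ∀ᶠ i in l, u i ≤ v i) : ∀ᶠ i in l, h (u i) ≤ h (v i) := by
  filter_upwards [hu.eventually (Ioc_mem_nhdsGT hδ), hv.eventually (Ioc_mem_nhdsGT hδ), huv]
    with i hui hvi hle using hmono hui hvi hle

theorem tendsto_nhdsGT_zero_of_tendsto_div {ι : Type*} {l : Filter ι} {u v : ι → ℝ} {c : ℝ}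
    (hc : 0 < c) (hu : Tendsto u l (𝓝[>] 0)) (huv : Tendsto (fun i => v i / u i) l (𝓝 c)) :
    Tendsto v l (𝓝[>] 0) := by
  have hpos : ∀ᶠ i in l, 0 < u i := hu.eventually self_mem_nhdsWithin
  refine tendsto_nhdsWithin_iff.2 ⟨?_, ?_⟩
  · have h := huv.mul (hu.mono_right nhdsWithin_le_nhds)
    rw [mul_zero] at h
    refine h.congr' ?_
    filter_upwards [hpos] with i hi using div_mul_cancel₀ _ hi.ne'
  · filter_upwards [hpos, huv.eventually_const_lt hc] with i hi hvi
    exact (div_pos_iff_of_pos_right hi).1 hvi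

theorem RegularlyVaryingAtZero.tendsto_div_of_monotoneOn {h : ℝ → ℝ} {ρ δ : ℝ}
    (hreg : RegularlyVaryingAtZero h ρ) (hδ : 0 < δ) (hmono : MonotoneOn h (Ioc 0 δ))
    (hpos : ∀ᶠ x in 𝓝[>] 0, 0 < h x) {ι : Type*} {l : Filter ι} {u v : ι → ℝ} {c : ℝ}
    (hc : 0 < c) (hu : Tendsto u l (𝓝[>] 0)) (huv : Tendsto (fun i => v i / u i) l (𝓝 c)) :
    Tendsto (fun i => h (v i) / h (u i)) l (𝓝 (c ^ ρ)) := by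
  have hv := tendsto_nhdsGT_zero_of_tendsto_div hc hu huv
  have hu_pos : ∀ᶠ i in l, 0 < u i := hu.eventually self_mem_nhdsWithin
  have hd_pos : ∀ᶠ d in 𝓝 c, 0 < d := lt_mem_nhds hc
  have hmul : ∀ {d : ℝ}, 0 < d → Tendsto (fun i => d * u i) l (𝓝[>] 0) :=
    fun hd => (tendsto_const_mul_nhdsGT_zero hd).comp hu
  refine tendsto_of_eventually_le_of_eventually_ge (G := fun d i => h (d * u i) / h (u i))
    ((Real.continuousAt_rpow_const c ρ (Or.inl hc.ne')).mono_left nhdsWithin_le_nhds) ?_ ?_ ?_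
  · filter_upwards [nhdsWithin_le_nhds hd_pos] with d hd using (hreg d hd).comp hu
  · filter_upwards [nhdsWithin_le_nhds hd_pos, self_mem_nhdsWithin] with d hd (hdc : d < c)
    have hle : ∀ᶠ i in l, d * u i ≤ v i := by
      filter_upwards [hu_pos, huv.eventually_const_lt hdc] with i hi hlt
      exact ((lt_div_iff₀ hi).1 hlt).le
    filter_upwards [eventually_comp_le_comp_of_monotoneOn hmono hδ (hmul hd) hv hle,
      hu.eventually hpos] with i hi hui using div_le_div_of_nonneg_right hi hui.le
  · filter_upwards [nhdsWithin_le_nhds hd_pos, self_mem_nhdsWithin] with d hd (hdc : c < d)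
    have hle : ∀ᶠ i in l, v i ≤ d * u i := by
      filter_upwards [hu_pos, huv.eventually_lt_const hdc] with i hi hlt
      exact ((div_lt_iff₀ hi).1 hlt).le
    filter_upwards [eventually_comp_le_comp_of_monotoneOn hmono hδ hv (hmul hd) hle,
      hu.eventually hpos] with i hi hui using div_le_div_of_nonneg_right hi hui.le

theorem RegularlyVaryingAtZero.tendsto_zero_of_monotoneOn {h : ℝ → ℝ} {ρ δ : ℝ}
    (hreg : RegularlyVaryingAtZero h ρ) (hρ : 0 < ρ) (hδ : 0 < δ)
    (hmono : MonotoneOn h (Ioc 0 δ)) (hpos : ∀ x ∈ Ioc 0 δ, 0 < h x) :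
    Tendsto h (𝓝[>] 0) (𝓝 0) := by
  have hbdd : BddBelow (h '' Ioo 0 δ) :=
    ⟨0, forall_mem_image.2 fun x hx => (hpos x (Ioo_subset_Ioc_self hx)).le⟩
  have hlim := MonotoneOn.tendsto_nhdsWithin_Ioo_right (nonempty_Ioo.2 hδ)
    (hmono.mono Ioo_subset_Ioc_self) hbdd
  set ℓ := sInf (h '' Ioo 0 δ)
  suffices hℓ : ℓ = 0 by rwa [hℓ] at hlim
  by_contra hℓ
  have hhalf : (0 : ℝ) < 1 / 2 := by norm_num
  -- A nonzero limit would force `h (x / 2) / h x → 1`, against the limit `(1 / 2) ^ ρ < 1`.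
  have hone := (hlim.comp (tendsto_const_mul_nhdsGT_zero hhalf)).div hlim hℓ
  rw [div_self hℓ] at hone
  exact (Real.rpow_lt_one hhalf.le (by norm_num) hρ).ne'
    (tendsto_nhds_unique hone (hreg (1 / 2) hhalf))

theorem RegularlyVaryingAtZero.tendsto_slope_div {g : ℝ → ℝ} {ρ c : ℝ}
    (hreg : RegularlyVaryingAtZero g ρ) (hpos : ∀ᶠ x in 𝓝[>] 0, 0 < g x) (hc₀ : 0 < c)
    (hc₁ : c ≠ 1) :
    Tendsto (fun x => slope g x (c * x) / (g x / x)) (𝓝[>] 0) (𝓝 (slope (· ^ ρ) 1 c)) := by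
  have h := ((hreg c hc₀).sub_const 1).div_const (c - 1)
  rw [slope_def_field, Real.one_rpow]
  refine h.congr' ?_
  filter_upwards [self_mem_nhdsWithin, hpos] with x (hx : 0 < x) hgx
  have hc : c - 1 ≠ 0 := sub_ne_zero.2 hc₁
  rw [slope_def_field, ← sub_one_mul]
  field_simp

theorem eventually_slope_le_slope {g q r : ℝ → ℝ} {δ : ℝ} (hconv : ConvexOn ℝ (Ioc 0 δ) g)
    (hδ : 0 < δ) (hq : Tendsto q (𝓝[>] 0) (𝓝[>] 0)) (hr : Tendsto r (𝓝[>] 0) (𝓝[>] 0))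
    (hqx : ∀ᶠ x in 𝓝[>] 0, q x ≠ x) (hrx : ∀ᶠ x in 𝓝[>] 0, r x ≠ x)
    (hqr : ∀ᶠ x in 𝓝[>] 0, q x ≤ r x) :
    ∀ᶠ x in 𝓝[>] 0, slope g x (q x) ≤ slope g x (r x) := by
  filter_upwards [Ioc_mem_nhdsGT hδ, hq.eventually (Ioc_mem_nhdsGT hδ),
    hr.eventually (Ioc_mem_nhdsGT hδ), hqx, hrx, hqr] with x hx hqδ hrδ hqx hrx hle
  exact hconv.slope_mono hx ⟨hqδ, hqx⟩ ⟨hrδ, hrx⟩ hle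

/-- Monotone density: convexity transfers the limit of the slopes of `g` from `[x, c x]`, for `c`
fixed and close to `1`, to `[x, p x]`. -/
theorem RegularlyVaryingAtZero.tendsto_slope_div_of_convexOn {g p : ℝ → ℝ} {ρ δ : ℝ}
    (hreg : RegularlyVaryingAtZero g ρ) (hδ : 0 < δ) (hconv : ConvexOn ℝ (Ioc 0 δ) g)
    (hpos : ∀ᶠ x in 𝓝[>] 0, 0 < g x) (hp : Tendsto (fun x => p x / x) (𝓝[>] 0) (𝓝 1))
    (hne : ∀ᶠ x in 𝓝[>] 0, p x ≠ x) :
    Tendsto (fun x => slope g x (p x) / (g x / x)) (𝓝[>] 0) (𝓝 ρ) := by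
  have hp₀ : Tendsto p (𝓝[>] 0) (𝓝[>] 0) :=
    tendsto_nhdsGT_zero_of_tendsto_div one_pos tendsto_id hp
  have hx_pos : ∀ᶠ x : ℝ in 𝓝[>] 0, 0 < x := self_mem_nhdsWithin
  have hdiv_pos : ∀ᶠ x in 𝓝[>] 0, 0 < g x / x := by
    filter_upwards [hpos, hx_pos] with x hgx hx using div_pos hgx hx
  have hd_pos : ∀ᶠ d : ℝ in 𝓝 1, 0 < d := lt_mem_nhds one_pos
  have hderiv : HasDerivAt (fun t : ℝ => t ^ ρ) ρ 1 := by
    simpa using Real.hasDerivAt_rpow_const (x := 1) (p := ρ) (Or.inl one_ne_zero)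
  have mul_ne : ∀ {d : ℝ}, d ≠ 1 → ∀ᶠ x in 𝓝[>] 0, d * x ≠ x := fun hd => by
    filter_upwards [hx_pos] with x hx using fun h => hd ((mul_eq_right₀ hx.ne').1 h)
  refine tendsto_of_eventually_le_of_eventually_ge
    (G := fun d x => slope g x (d * x) / (g x / x)) hderiv.tendsto_slope ?_ ?_ ?_
  · filter_upwards [nhdsWithin_le_nhds hd_pos, self_mem_nhdsWithin] with d hd hd₁
    exact hreg.tendsto_slope_div hpos hd hd₁
  · filter_upwards [nhdsWithin_le_nhds hd_pos, self_mem_nhdsWithin] with d hd (hd₁ : d < 1)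
    have hle : ∀ᶠ x in 𝓝[>] 0, d * x ≤ p x := by
      filter_upwards [hx_pos, hp.eventually_const_lt hd₁] with x hx hlt
      exact ((lt_div_iff₀ hx).1 hlt).le
    filter_upwards [hdiv_pos, eventually_slope_le_slope hconv hδ (tendsto_const_mul_nhdsGT_zero hd)
      hp₀ (mul_ne hd₁.ne) hne hle] with x hx hslope using div_le_div_of_nonneg_right hslope hx.le
  · filter_upwards [nhdsWithin_le_nhds hd_pos, self_mem_nhdsWithin] with d hd (hd₁ : 1 < d)
    have hle : ∀ᶠ x in 𝓝[>] 0, p x ≤ d * x := by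
      filter_upwards [hx_pos, hp.eventually_lt_const hd₁] with x hx hlt
      exact ((div_lt_iff₀ hx).1 hlt).le
    filter_upwards [hdiv_pos, eventually_slope_le_slope hconv hδ hp₀
      (tendsto_const_mul_nhdsGT_zero hd) hne (mul_ne hd₁.ne') hle] with x hx hslope
      using div_le_div_of_nonneg_right hslope hx.le

end RegularVariation

section Descent

open Set

variable {F : ℝ → ℝ} {α : ℝ}

/-- The relative decrement `(x - F x) / x` of a self-map `F` at `x`. -/
noncomputable def relDecrement (F : ℝ → ℝ) (x : ℝ) : ℝ := (x - F x) / x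

theorem sub_iterate_succ (F : ℝ → ℝ) (n : ℕ) {x : ℝ} (hx : F^[n] x ≠ 0) :
    F^[n] x - F^[n + 1] x = F^[n] x * relDecrement F (F^[n] x) := by
  rw [Function.iterate_succ_apply', relDecrement, mul_div_cancel₀ _ hx]

/-- `F` is a concave increasing self-map of `[0, 1]` whose decrement `x - F x` is positive and
regularly varying at its parabolic fixed point `0`. For a critical generating function `f` in the
domain of attraction of a stable law of index `1 + α`, this is the map `x ↦ 1 - f (1 - x)`, whose
iterates at `1` are the survival probabilities. -/
structure IsRegularDescent (F : ℝ → ℝ) (α : ℝ) : Prop where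
  index_pos : 0 < α
  concaveOn : ConcaveOn ℝ (Icc 0 1) F
  monotoneOn : MonotoneOn F (Icc 0 1)
  map_zero : F 0 = 0
  lt_self : ∀ x ∈ Ioc (0 : ℝ) 1, F x < x
  regularlyVarying : RegularlyVaryingAtZero (fun x => x - F x) (1 + α)

namespace IsRegularDescent

theorem relDecrement_pos (H : IsRegularDescent F α) {x : ℝ} (hx : x ∈ Ioc (0 : ℝ) 1) :
    0 < relDecrement F x :=
  div_pos (sub_pos.2 (H.lt_self x hx)) hx.1

theorem convexOn_sub (H : IsRegularDescent F α) : ConvexOn ℝ (Icc 0 1) (fun x => x - F x) :=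
  (convexOn_id (convex_Icc 0 1)).sub H.concaveOn

theorem monotoneOn_relDecrement (H : IsRegularDescent F α) :
    MonotoneOn (relDecrement F) (Ioc 0 1) := by
  intro x hx y hy hxy
  have h := H.convexOn_sub.slope_mono (left_mem_Icc.2 zero_le_one)
    ⟨Ioc_subset_Icc_self hx, hx.1.ne'⟩ ⟨Ioc_subset_Icc_self hy, hy.1.ne'⟩ hxy
  simpa only [slope_def_field, H.map_zero, sub_zero, relDecrement] using h

theorem regularlyVarying_relDecrement (H : IsRegularDescent F α) :
    RegularlyVaryingAtZero (relDecrement F) α := by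
  have h := H.regularlyVarying.div_id
  rwa [add_sub_cancel_left] at h

theorem tendsto_relDecrement_div (H : IsRegularDescent F α) {ι : Type*} {l : Filter ι}
    {u v : ι → ℝ} {c : ℝ} (hc : 0 < c) (hu : Tendsto u l (𝓝[>] 0))
    (huv : Tendsto (fun i => v i / u i) l (𝓝 c)) :
    Tendsto (fun i => relDecrement F (v i) / relDecrement F (u i)) l (𝓝 (c ^ α)) :=
  H.regularlyVarying_relDecrement.tendsto_div_of_monotoneOn one_pos H.monotoneOn_relDecrement
    (eventually_of_mem (Ioc_mem_nhdsGT one_pos) fun _ => H.relDecrement_pos) hc hu huv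

theorem tendsto_relDecrement (H : IsRegularDescent F α) :
    Tendsto (relDecrement F) (𝓝[>] 0) (𝓝 0) :=
  H.regularlyVarying_relDecrement.tendsto_zero_of_monotoneOn H.index_pos one_pos
    H.monotoneOn_relDecrement fun _ => H.relDecrement_pos

theorem tendsto_map_div_self (H : IsRegularDescent F α) :
    Tendsto (fun x => F x / x) (𝓝[>] 0) (𝓝 1) := by
  have h := H.tendsto_relDecrement.const_sub 1
  rw [sub_zero] at h
  refine h.congr' ?_
  filter_upwards [self_mem_nhdsWithin] with x (hx : 0 < x)
  rw [relDecrement, sub_div, div_self hx.ne', sub_sub_cancel]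

theorem map_mem_Ioc (H : IsRegularDescent F α) {x : ℝ} (hx : x ∈ Ioc (0 : ℝ) 1) :
    F x ∈ Ioc (0 : ℝ) 1 := by
  refine ⟨?_, (H.lt_self x hx).le.trans hx.2⟩
  obtain ⟨y, hyF, hy₀, hyx⟩ := ((H.tendsto_map_div_self.eventually_const_lt one_pos).and
    (Ioc_mem_nhdsGT hx.1)).exists
  exact ((div_pos_iff_of_pos_right hy₀).1 hyF).trans_le
    (H.monotoneOn ⟨hy₀.le, hyx.trans hx.2⟩ (Ioc_subset_Icc_self hx) hyx)

/-- This is where the rate `1 / (α n)` comes from: along an orbit, the inverse of the relative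
decrement grows by about `α` at each step. -/
theorem tendsto_inv_relDecrement_map_sub (H : IsRegularDescent F α) :
    Tendsto (fun x => (relDecrement F (F x))⁻¹ - (relDecrement F x)⁻¹) (𝓝[>] 0) (𝓝 α) := by
  have hIoc : ∀ᶠ x : ℝ in 𝓝[>] 0, x ∈ Ioc (0 : ℝ) 1 := Ioc_mem_nhdsGT one_pos
  have hslope := H.regularlyVarying.tendsto_slope_div_of_convexOn one_pos
    (H.convexOn_sub.subset Ioc_subset_Icc_self (convex_Ioc 0 1))
    (hIoc.mono fun x hx => sub_pos.2 (H.lt_self x hx)) H.tendsto_map_div_self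
    (hIoc.mono fun x hx => (H.lt_self x hx).ne)
  have hratio := H.tendsto_relDecrement_div one_pos tendsto_id H.tendsto_map_div_self
  have h := ((hslope.sub_const 1).div H.tendsto_map_div_self one_ne_zero).div hratio (by simp)
  rw [Real.one_rpow, div_one, div_one, add_sub_cancel_left] at h
  refine h.congr' ?_
  filter_upwards [hIoc] with x hx
  have hx₀ := hx.1
  have hFx₀ := (H.map_mem_Ioc hx).1
  have hx_dec : x - F x ≠ 0 := (sub_pos.2 (H.lt_self x hx)).ne'
  have hFx_dec : F x - F (F x) ≠ 0 := (sub_pos.2 (H.lt_self _ (H.map_mem_Ioc hx))).ne'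
  have hFx_sub : F x - x ≠ 0 := (sub_neg.2 (H.lt_self x hx)).ne
  simp only [Pi.div_apply, id_eq, slope_def_field, relDecrement]
  field_simp
  ring

theorem iterate_mem_Ioc (H : IsRegularDescent F α) (n : ℕ) {x : ℝ} (hx : x ∈ Ioc (0 : ℝ) 1) :
    F^[n] x ∈ Ioc (0 : ℝ) 1 :=
  (show MapsTo F (Ioc 0 1) (Ioc 0 1) from fun _ => H.map_mem_Ioc).iterate n hx

theorem iterate_one_mem_Ioc (H : IsRegularDescent F α) (n : ℕ) : F^[n] 1 ∈ Ioc (0 : ℝ) 1 :=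
  H.iterate_mem_Ioc n ⟨one_pos, le_rfl⟩

theorem antitone_iterate_one (H : IsRegularDescent F α) : Antitone fun n => F^[n] 1 :=
  antitone_nat_of_succ_le fun n => by
    simpa only [Function.iterate_succ_apply'] using (H.lt_self _ (H.iterate_one_mem_Ioc n)).le

theorem iterate_le_iterate (H : IsRegularDescent F α) (n : ℕ) {x y : ℝ}
    (hx : x ∈ Ioc (0 : ℝ) 1) (hy : y ∈ Ioc (0 : ℝ) 1) (hxy : x ≤ y) : F^[n] x ≤ F^[n] y := by
  induction n with
  | zero => simpa using hxy
  | succ n ih =>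
    rw [Function.iterate_succ_apply', Function.iterate_succ_apply']
    exact H.monotoneOn (Ioc_subset_Icc_self (H.iterate_mem_Ioc n hx))
      (Ioc_subset_Icc_self (H.iterate_mem_Ioc n hy)) ih

theorem tendsto_iterate_one (H : IsRegularDescent F α) :
    Tendsto (fun n => F^[n] 1) atTop (𝓝[>] 0) := by
  have hmem := H.iterate_one_mem_Ioc
  refine tendsto_nhdsWithin_iff.2 ⟨?_, .of_forall fun n => (hmem n).1⟩
  have hbdd : BddBelow (range fun n => F^[n] 1) := ⟨0, forall_mem_range.2 fun n => (hmem n).1.le⟩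
  have hlim := tendsto_atTop_ciInf H.antitone_iterate_one hbdd
  set ℓ := ⨅ n, F^[n] 1
  have hle : ∀ n, ℓ ≤ F^[n] 1 := ciInf_le hbdd
  suffices hℓ : ℓ = 0 by rwa [hℓ] at hlim
  by_contra hℓ
  have hℓ_pos : 0 < ℓ := (le_ciInf fun n => (hmem n).1.le).lt_of_ne' hℓ
  have hℓ_mem : ℓ ∈ Ioc (0 : ℝ) 1 := ⟨hℓ_pos, (hle 0).trans (hmem 0).2⟩
  have hstep : ∀ n, F^[n + 1] 1 ≤ F^[n] 1 - F^[n] 1 * relDecrement F ℓ := fun n => by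
    rw [← sub_sub_cancel (F^[n] 1) (F^[n + 1] 1), sub_iterate_succ F n (hmem n).1.ne']
    have := (hmem n).1.le
    gcongr
    exact H.monotoneOn_relDecrement hℓ_mem (hmem n) (hle n)
  have hlim_le : ℓ ≤ ℓ - ℓ * relDecrement F ℓ :=
    le_of_tendsto_of_tendsto' (hlim.comp (tendsto_add_atTop_nat 1))
      (hlim.sub (hlim.mul_const _)) hstep
  linarith [mul_pos hℓ_pos (H.relDecrement_pos hℓ_mem)]

theorem tendsto_mul_relDecrement_iterate (H : IsRegularDescent F α) :
    Tendsto (fun n : ℕ => n * relDecrement F (F^[n] 1)) atTop (𝓝 α⁻¹) := by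
  have hincr : Tendsto (fun n => (relDecrement F (F^[n + 1] 1))⁻¹ - (relDecrement F (F^[n] 1))⁻¹)
      atTop (𝓝 α) := by
    simpa only [Function.comp_def, ← Function.iterate_succ_apply'] using
      H.tendsto_inv_relDecrement_map_sub.comp H.tendsto_iterate_one
  have hcesaro := hincr.cesaro
  simp_rw [Finset.sum_range_sub fun n => (relDecrement F (F^[n] 1))⁻¹] at hcesaro
  have hstart := (tendsto_inv_atTop_nhds_zero_nat (𝕜 := ℝ)).mul_const (relDecrement F (F^[0] 1))⁻¹
  have h := (hcesaro.add hstart).inv₀ (by simpa using H.index_pos.ne')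
  rw [zero_mul, add_zero] at h
  refine h.congr fun n => ?_
  rw [← mul_add, sub_add_cancel, mul_inv, inv_inv, inv_inv]

theorem exists_iterate_lt_and_le (H : IsRegularDescent F α) {u : ℝ} (hu : u ∈ Ioc (0 : ℝ) 1) :
    ∃ k, F^[k + 1] 1 < u ∧ u ≤ F^[k] 1 := by
  classical
  have hex : ∃ k, F^[k] 1 < u :=
    ((H.tendsto_iterate_one.mono_right nhdsWithin_le_nhds).eventually_lt_const hu.1).exists
  obtain ⟨k, hk⟩ : ∃ k, Nat.find hex = k + 1 :=
    Nat.exists_eq_succ_of_ne_zero ((Nat.find_pos hex).2 (not_lt.2 hu.2)).ne'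
  exact ⟨k, hk ▸ Nat.find_spec hex, not_lt.1 (Nat.find_min hex (by lia))⟩

theorem tendsto_atTop_of_iterate_lt (H : IsRegularDescent F α) {ι : Type*} {l : Filter ι}
    {u : ι → ℝ} (hu : Tendsto u l (𝓝[>] 0)) {k : ι → ℕ}
    (hlt : ∀ᶠ i in l, F^[k i + 1] 1 < u i) : Tendsto k l atTop := by
  refine tendsto_atTop.2 fun b => ?_
  filter_upwards [hlt, (hu.mono_right nhdsWithin_le_nhds).eventually_lt_const
    (H.iterate_one_mem_Ioc b).1] with i hki hub
  by_contra! hkb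
  exact (hki.trans hub).not_ge (H.antitone_iterate_one hkb)

theorem tendsto_mul_relDecrement_of_iterate_lt_and_le (H : IsRegularDescent F α) {ι : Type*}
    {l : Filter ι} {u : ι → ℝ} (hu : Tendsto u l (𝓝[>] 0)) {k : ι → ℕ}
    (hlt : ∀ᶠ i in l, F^[k i + 1] 1 < u i) (hle : ∀ᶠ i in l, u i ≤ F^[k i] 1) :
    Tendsto (fun i => k i * relDecrement F (u i)) l (𝓝 α⁻¹) := by
  have hk := H.tendsto_atTop_of_iterate_lt hu hlt
  have hmem : ∀ᶠ i in l, u i ∈ Ioc (0 : ℝ) 1 := hu.eventually (Ioc_mem_nhdsGT one_pos)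
  have hupper := H.tendsto_mul_relDecrement_iterate.comp hk
  have hlower := ((tendsto_natCast_div_add_atTop (1 : ℝ)).comp hk).mul
    (H.tendsto_mul_relDecrement_iterate.comp ((tendsto_add_atTop_nat 1).comp hk))
  rw [one_mul] at hlower
  refine tendsto_of_tendsto_of_tendsto_of_le_of_le' hlower hupper ?_ ?_
  · filter_upwards [hlt, hmem] with i hi hui
    have hmono := H.monotoneOn_relDecrement (H.iterate_one_mem_Ioc (k i + 1)) hui hi.le
    simp only [Function.comp_apply, Nat.cast_add, Nat.cast_one]
    rw [← mul_assoc, div_mul_cancel₀ _ (by positivity)]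
    gcongr
  · filter_upwards [hle, hmem] with i hi hui
    exact mul_le_mul_of_nonneg_left
      (H.monotoneOn_relDecrement hui (H.iterate_one_mem_Ioc (k i)) hi) (Nat.cast_nonneg _)

theorem antitone_iterate_mul_relDecrement (H : IsRegularDescent F α) :
    Antitone fun n => F^[n] 1 * relDecrement F (F^[n] 1) := fun m n hmn => by
  have hm := H.iterate_one_mem_Ioc m
  have hn := H.iterate_one_mem_Ioc n
  have hle := H.antitone_iterate_one hmn
  exact mul_le_mul hle (H.monotoneOn_relDecrement hn hm hle) (H.relDecrement_pos hn).le hm.1.le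

theorem iterate_sub_iterate_add (H : IsRegularDescent F α) (n k : ℕ) :
    F^[n] 1 - F^[n + k] 1 =
      ∑ i ∈ Finset.range k, F^[n + i] 1 * relDecrement F (F^[n + i] 1) := by
  rw [← add_zero n, add_assoc, zero_add, ← Finset.sum_range_sub' fun i => F^[n + i] 1]
  exact Finset.sum_congr rfl fun i _ => sub_iterate_succ F _ (H.iterate_one_mem_Ioc _).1.ne'

theorem iterate_sub_iterate_add_le (H : IsRegularDescent F α) (n k : ℕ) :
    F^[n] 1 - F^[n + k] 1 ≤ k * (F^[n] 1 * relDecrement F (F^[n] 1)) := by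
  rw [H.iterate_sub_iterate_add]
  simpa only [Finset.card_range, nsmul_eq_mul] using Finset.sum_le_card_nsmul (Finset.range k) _ _
    fun i _ => H.antitone_iterate_mul_relDecrement (Nat.le_add_right n i)

theorem mul_le_iterate_sub_iterate_add (H : IsRegularDescent F α) (n k : ℕ) :
    k * (F^[n + k] 1 * relDecrement F (F^[n + k] 1)) ≤ F^[n] 1 - F^[n + k] 1 := by
  rw [H.iterate_sub_iterate_add]
  simpa only [Finset.card_range, nsmul_eq_mul] using Finset.card_nsmul_le_sum (Finset.range k) _ _
    fun i hi => H.antitone_iterate_mul_relDecrement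
      (Nat.add_le_add_left (Finset.mem_range.1 hi).le n)

theorem tendsto_iterate_add_div (H : IsRegularDescent F α) {k : ℕ → ℕ}
    (hk : Tendsto (fun n => (k n : ℝ) / n) atTop (𝓝 0)) :
    Tendsto (fun n => F^[n + k n] 1 / F^[n] 1) atTop (𝓝 1) := by
  have hlower := (hk.mul H.tendsto_mul_relDecrement_iterate).const_sub 1
  rw [zero_mul, sub_zero] at hlower
  refine tendsto_of_tendsto_of_tendsto_of_le_of_le' hlower tendsto_const_nhds ?_ ?_
  · filter_upwards [eventually_gt_atTop 0] with n hn
    have hn₀ : (n : ℝ) ≠ 0 := by positivity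
    rw [← mul_assoc, div_mul_cancel₀ _ hn₀, le_div_iff₀ (H.iterate_one_mem_Ioc n).1]
    linarith [H.iterate_sub_iterate_add_le n (k n)]
  · exact .of_forall fun n => div_le_one_of_le₀
      (H.antitone_iterate_one (Nat.le_add_right n (k n))) (H.iterate_one_mem_Ioc n).1.le

theorem tendsto_iterate_sub_iterate_add (H : IsRegularDescent F α) {k : ℕ → ℕ} {m : ℕ → ℝ} {κ : ℝ}
    (hm : ∀ᶠ n in atTop, 0 < m n) (hmn : Tendsto (fun n => m n / n) atTop (𝓝 0))
    (hk : Tendsto (fun n => k n / m n) atTop (𝓝 κ)) :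
    Tendsto (fun n => (F^[n] 1 - F^[n + k n] 1) * n / (F^[n] 1 * m n)) atTop (𝓝 (κ * α⁻¹)) := by
  have hkn : Tendsto (fun n => (k n : ℝ) / n) atTop (𝓝 0) := by
    have h := hk.mul hmn
    rw [mul_zero] at h
    refine h.congr' ?_
    filter_upwards [hm] with n hn using div_mul_div_cancel₀ hn.ne'
  have hindex : Tendsto (fun n => (1 + (k n : ℝ) / n)⁻¹) atTop (𝓝 1) := by
    simpa using (hkn.const_add 1).inv₀ (by simp)
  have hshift := H.tendsto_mul_relDecrement_iterate.comp
    (tendsto_atTop_mono (fun n => Nat.le_add_right n (k n)) tendsto_id)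
  have hlower := (hk.mul hshift).mul ((H.tendsto_iterate_add_div hkn).mul hindex)
  rw [mul_one, mul_one] at hlower
  refine tendsto_of_tendsto_of_tendsto_of_le_of_le' hlower
    (hk.mul H.tendsto_mul_relDecrement_iterate) ?_ ?_
  · filter_upwards [hm, eventually_gt_atTop 0] with n hmn hn
    have he := (H.iterate_one_mem_Ioc n).1
    calc _ = k n * (F^[n + k n] 1 * relDecrement F (F^[n + k n] 1)) * n / (F^[n] 1 * m n) := by
          simp only [Function.comp_apply, Nat.cast_add]
          field_simp
      _ ≤ _ := by
          gcongr
          exact H.mul_le_iterate_sub_iterate_add n (k n)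
  · filter_upwards [hm] with n hmn
    have he := (H.iterate_one_mem_Ioc n).1
    calc _ ≤ k n * (F^[n] 1 * relDecrement F (F^[n] 1)) * n / (F^[n] 1 * m n) := by
          gcongr
          exact H.iterate_sub_iterate_add_le n (k n)
      _ = _ := by field_simp

theorem tendsto_hitting_index_div (H : IsRegularDescent F α) {ι : Type*} {l : Filter ι} {c : ℝ}
    (hc : 0 < c) {j k : ι → ℕ} {u : ι → ℝ} (hj : Tendsto j l atTop)
    (hu : Tendsto (fun i => u i / F^[j i] 1) l (𝓝 c)) (hlt : ∀ᶠ i in l, F^[k i + 1] 1 < u i)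
    (hle : ∀ᶠ i in l, u i ≤ F^[k i] 1) :
    Tendsto (fun i => (k i : ℝ) / j i) l (𝓝 (c ^ (-α))) := by
  have he := H.tendsto_iterate_one.comp hj
  have hu₀ : Tendsto u l (𝓝[>] 0) := tendsto_nhdsGT_zero_of_tendsto_div hc he hu
  have hα := inv_ne_zero H.index_pos.ne'
  have h := ((H.tendsto_mul_relDecrement_of_iterate_lt_and_le hu₀ hlt hle).div
    (H.tendsto_mul_relDecrement_iterate.comp hj) hα).div
    (H.tendsto_relDecrement_div hc he hu) (Real.rpow_pos_of_pos hc α).ne'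
  rw [div_self hα, one_div, ← Real.rpow_neg hc.le] at h
  refine h.congr' ?_
  filter_upwards [hu₀.eventually (Ioc_mem_nhdsGT one_pos)] with i hi
  have hhu := (H.relDecrement_pos hi).ne'
  have hhe := (H.relDecrement_pos (H.iterate_one_mem_Ioc (j i))).ne'
  simp only [Pi.div_apply, Function.comp_apply]
  field_simp

/-- A starting point comparable to the `⌊φ n⌋₊`-th term of the orbit of `1` is reached by that
orbit after about `c ^ (-α) * φ n` steps. -/
theorem tendsto_iterate_one_sub_iterate (H : IsRegularDescent F α) {φ u : ℕ → ℝ} {c : ℝ}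
    (hc : 0 < c) (hφ : Tendsto φ atTop atTop) (hφn : Tendsto (fun n => φ n / n) atTop (𝓝 0))
    (hu : Tendsto (fun n => u n / F^[⌊φ n⌋₊] 1) atTop (𝓝 c)) :
    Tendsto (fun n => (F^[n] 1 - F^[n] (u n)) * n / (F^[n] 1 * φ n)) atTop
      (𝓝 (c ^ (-α) * α⁻¹)) := by
  have hfloor : Tendsto (fun n => ⌊φ n⌋₊) atTop atTop := tendsto_nat_floor_atTop.comp hφ
  have hu_mem : ∀ᶠ n in atTop, u n ∈ Ioc (0 : ℝ) 1 :=
    (tendsto_nhdsGT_zero_of_tendsto_div hc (H.tendsto_iterate_one.comp hfloor) hu).eventually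
      (Ioc_mem_nhdsGT one_pos)
  obtain ⟨k, hk⟩ := (hu_mem.mono fun n => H.exists_iterate_lt_and_le).choice
  have hφ_pos : ∀ᶠ n in atTop, 0 < φ n := hφ.eventually_gt_atTop 0
  have hkφ : Tendsto (fun n => k n / φ n) atTop (𝓝 (c ^ (-α))) := by
    have h := (H.tendsto_hitting_index_div hc hfloor hu (hk.mono fun _ => And.left)
      (hk.mono fun _ => And.right)).mul ((tendsto_nat_floor_div_atTop (R := ℝ)).comp hφ)
    rw [mul_one] at h
    refine h.congr' ?_
    filter_upwards [hfloor.eventually_gt_atTop 0] with n hn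
    exact div_mul_div_cancel₀ (Nat.cast_ne_zero.2 hn.ne')
  have hkφ' : Tendsto (fun n => ((k n + 1 : ℕ) : ℝ) / φ n) atTop (𝓝 (c ^ (-α))) := by
    simpa [add_div] using hkφ.add (tendsto_inv_atTop_zero.comp hφ)
  refine tendsto_of_tendsto_of_tendsto_of_le_of_le'
    (H.tendsto_iterate_sub_iterate_add hφ_pos hφn hkφ)
    (H.tendsto_iterate_sub_iterate_add hφ_pos hφn hkφ') ?_ ?_
  all_goals
    filter_upwards [hk, hu_mem, hφ_pos] with n hkn hun hφn
    have he := (H.iterate_one_mem_Ioc n).1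
    rw [Function.iterate_add_apply]
    gcongr
  · exact H.iterate_le_iterate n hun (H.iterate_one_mem_Ioc _) hkn.2
  · exact H.iterate_le_iterate n (H.iterate_one_mem_Ioc _) hun hkn.1.le

end IsRegularDescent

end Descent

section GeneratingFunction

open Set

variable {ν : Measure ℕ} [IsProbabilityMeasure ν]

theorem integrable_pow_of_mem_Icc {s : ℝ} (hs : s ∈ Icc (0 : ℝ) 1) :
    Integrable (fun k : ℕ => s ^ k) ν := by
  refine .of_bound (measurable_of_countable _).aestronglyMeasurable 1 (.of_forall fun k => ?_)
  rw [Real.norm_of_nonneg (pow_nonneg hs.1 k)]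
  exact pow_le_one₀ hs.1 hs.2

theorem pgf_one : pgf ν 1 = 1 := by simp [pgf]

theorem monotoneOn_pgf : MonotoneOn (pgf ν) (Icc 0 1) := fun _ hs _ ht hst =>
  integral_mono (integrable_pow_of_mem_Icc hs) (integrable_pow_of_mem_Icc ht)
    fun k => pow_le_pow_left₀ hs.1 hst k

theorem pgf_mem_Icc {s : ℝ} (hs : s ∈ Icc (0 : ℝ) 1) : pgf ν s ∈ Icc (0 : ℝ) 1 :=
  ⟨integral_nonneg fun k => pow_nonneg hs.1 k,
    (monotoneOn_pgf hs (right_mem_Icc.2 zero_le_one) hs.2).trans_eq pgf_one⟩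

theorem convexOn_pgf : ConvexOn ℝ (Icc 0 1) (pgf ν) := by
  refine ⟨convex_Icc 0 1, fun x hx y hy a b ha hb hab => ?_⟩
  have hx_int := integrable_pow_of_mem_Icc (ν := ν) hx
  have hy_int := integrable_pow_of_mem_Icc (ν := ν) hy
  simp only [smul_eq_mul, pgf]
  rw [← integral_const_mul, ← integral_const_mul,
    ← integral_add (hx_int.const_mul a) (hy_int.const_mul b)]
  exact integral_mono (integrable_pow_of_mem_Icc (convex_Icc (0 : ℝ) 1 hx hy ha hb hab))
    ((hx_int.const_mul a).add (hy_int.const_mul b))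
    fun k => (convexOn_pow k).2 hx.1 hy.1 ha hb hab

/-- The survival form `x ↦ 1 - f (1 - x)` of the generating function `f` of `ν`: it sends the
probability of surviving to one generation to that of surviving to the next. -/
noncomputable def survivalMap (ν : Measure ℕ) (x : ℝ) : ℝ := 1 - pgf ν (1 - x)

theorem iterate_survivalMap (ν : Measure ℕ) (n : ℕ) (x : ℝ) :
    (survivalMap ν)^[n] x = 1 - (pgf ν)^[n] (1 - x) := by
  have h : Function.Semiconj (fun s => 1 - s) (pgf ν) (survivalMap ν) := fun s => by
    rw [survivalMap, sub_sub_cancel]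
  simpa only [sub_sub_cancel] using ((h.iterate_right n).eq (1 - x)).symm

theorem survivalMap_zero : survivalMap ν 0 = 0 := by rw [survivalMap, sub_zero, pgf_one, sub_self]

theorem monotoneOn_survivalMap : MonotoneOn (survivalMap ν) (Icc 0 1) := fun _ hx _ hy hxy =>
  sub_le_sub_left (monotoneOn_pgf (Icc.one_sub_mem hy) (Icc.one_sub_mem hx)
    (sub_le_sub_left hxy 1)) 1

theorem concaveOn_survivalMap : ConcaveOn ℝ (Icc 0 1) (survivalMap ν) := by
  refine ⟨convex_Icc 0 1, fun x hx y hy a b ha hb hab => ?_⟩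
  have h := (convexOn_pgf (ν := ν)).2 (Icc.one_sub_mem hx)
    (Icc.one_sub_mem hy) ha hb hab
  have hcomb : a * (1 - x) + b * (1 - y) = 1 - (a * x + b * y) := by linear_combination hab
  simp only [smul_eq_mul, survivalMap] at h ⊢
  rw [hcomb] at h
  linarith

theorem lt_of_convexOn_of_eventually_lt {g : ℝ → ℝ} {a b : ℝ} (hconv : ConvexOn ℝ (Icc a b) g)
    (hg : ∀ᶠ y in 𝓝[>] a, g a < g y) {x : ℝ} (hx : x ∈ Ioc a b) : g a < g x := by
  obtain ⟨y, hy, hyx⟩ := (hg.and (Ioo_mem_nhdsGT hx.1)).exists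
  refine hy.trans (hconv.lt_right_of_left_lt (left_mem_Icc.2 (hx.1.le.trans hx.2))
    (Ioc_subset_Icc_self hx) ?_ hy)
  rwa [openSegment_eq_Ioo hx.1]

theorem isRegularDescent_survivalMap {α : ℝ} {L : ℝ → ℝ} (hα : 0 < α)
    (hL : SlowlyVaryingAtZero L)
    (hf : ∀ s ∈ Icc (0 : ℝ) 1, pgf ν s = s + (1 - s) ^ (1 + α) * L (1 - s)) :
    IsRegularDescent (survivalMap ν) α := by
  have hdec : ∀ x ∈ Icc (0 : ℝ) 1, x - survivalMap ν x = x ^ (1 + α) * L x := fun x hx => by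
    rw [survivalMap, hf _ (Icc.one_sub_mem hx), sub_sub_cancel]
    ring
  have hIcc : ∀ᶠ x in 𝓝[>] 0, x ∈ Icc (0 : ℝ) 1 := Icc_mem_nhdsGT one_pos
  have hdec_pos : ∀ᶠ x in 𝓝[>] 0, 0 - survivalMap ν 0 < x - survivalMap ν x := by
    filter_upwards [hIcc, hL.1, self_mem_nhdsWithin] with x hx hLx (hx₀ : 0 < x)
    rw [hdec x hx, survivalMap_zero, sub_self]
    positivity
  have hconv := (convexOn_id (convex_Icc (0 : ℝ) 1)).sub (concaveOn_survivalMap (ν := ν))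
  refine ⟨hα, concaveOn_survivalMap, monotoneOn_survivalMap, survivalMap_zero, fun x hx => ?_,
    (hL.regularlyVaryingAtZero_rpow_mul (1 + α)).congr (hIcc.mono fun x hx => (hdec x hx).symm)⟩
  have h := lt_of_convexOn_of_eventually_lt hconv hdec_pos hx
  simpa [survivalMap_zero] using h

end GeneratingFunction

theorem tendsto_one_sub_exp_neg_mul_div (c : ℝ) :
    Tendsto (fun x => (1 - Real.exp (-c * x)) / x) (𝓝[>] 0) (𝓝 c) := by
  have hderiv : HasDerivAt (fun x => 1 - Real.exp (-c * x)) c 0 := by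
    simpa using (((hasDerivAt_id (0 : ℝ)).const_mul (-c)).exp).const_sub 1
  refine (hderiv.tendsto_slope.mono_left (nhdsGT_le_nhdsNE 0)).congr fun x => ?_
  simp [slope_def_field]

section LaplaceTransform

open Set

theorem exp_neg_mul_mem_Icc {c x : ℝ} (hc : 0 ≤ c) (hx : 0 ≤ x) :
    Real.exp (-c * x) ∈ Icc (0 : ℝ) 1 :=
  ⟨(Real.exp_pos _).le,
    Real.exp_le_one_iff.2 (mul_nonpos_of_nonpos_of_nonneg (neg_nonpos.2 hc) hx)⟩

/-- The measure `U` lives on `[0, ∞)` and its Laplace transform is finite on `(0, ∞)`. The total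
mass of `U` may be infinite, as it is for the limit measure of interest. -/
structure HasLaplaceTransform (U : Measure ℝ) : Prop where
  ae_nonneg : ∀ᵐ x ∂U, 0 ≤ x
  integrable_exp : ∀ c : ℝ, 0 < c → Integrable (fun x => Real.exp (-c * x)) U

theorem exists_polynomial_near_exp_neg {w : ℝ → ℝ} (hw : Continuous w) {R : ℝ}
    (hwR : ∀ x, R ≤ x → w x = 0) {η : ℝ} (hη : 0 < η) :
    ∃ p : Polynomial ℝ, ∀ x, 0 ≤ x →
      |w x - Real.exp (-x) * p.eval (Real.exp (-x))| ≤ η * Real.exp (-x) := by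
  -- Weierstrass for `W t = w (-log t) / t`; truncating `t` at `exp (-R)`, below which `w (-log t)`
  -- vanishes, makes `W` continuous at `0`.
  set τ : ℝ → ℝ := fun t => max t (Real.exp (-R))
  set W : ℝ → ℝ := fun t => w (-Real.log (τ t)) / τ t
  have hτ_ne : ∀ t, τ t ≠ 0 := fun t => (lt_max_of_lt_right (Real.exp_pos _)).ne'
  have hτ : Continuous τ := by fun_prop
  have hW : Continuous W := (hw.comp (hτ.log hτ_ne).neg).div hτ hτ_ne
  have hW_exp : ∀ x, Real.exp (-x) * W (Real.exp (-x)) = w x := fun x => by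
    rcases le_total x R with hxR | hRx
    · have hτx : τ (Real.exp (-x)) = Real.exp (-x) :=
        max_eq_left (Real.exp_le_exp.2 (neg_le_neg hxR))
      simp only [W, hτx, Real.log_exp, neg_neg]
      exact mul_div_cancel₀ _ (Real.exp_ne_zero _)
    · have hτx : τ (Real.exp (-x)) = Real.exp (-R) :=
        max_eq_right (Real.exp_le_exp.2 (neg_le_neg hRx))
      simp only [W, hτx, Real.log_exp, neg_neg, hwR R le_rfl, hwR x hRx, zero_div, mul_zero]
  obtain ⟨p, hp⟩ := exists_polynomial_near_of_continuousOn 0 1 W hW.continuousOn η hη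
  refine ⟨p, fun x hx => ?_⟩
  have hexp_mem : Real.exp (-x) ∈ Icc (0 : ℝ) 1 := by
    simpa using exp_neg_mul_mem_Icc zero_le_one hx
  rw [← hW_exp x, ← mul_sub, abs_mul, abs_of_pos (Real.exp_pos _), abs_sub_comm, mul_comm]
  exact mul_le_mul_of_nonneg_right (hp _ hexp_mem).le hexp_mem.1

theorem exp_neg_mul_eval_eq_sum (p : Polynomial ℝ) (x : ℝ) :
    Real.exp (-x) * p.eval (Real.exp (-x)) =
      ∑ i ∈ Finset.range (p.natDegree + 1), p.coeff i * Real.exp (-((i : ℝ) + 1) * x) := by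
  rw [Polynomial.eval_eq_sum_range, Finset.mul_sum]
  refine Finset.sum_congr rfl fun i _ => ?_
  rw [← Real.exp_nat_mul, mul_left_comm, ← Real.exp_add]
  congr 2
  ring

namespace HasLaplaceTransform

variable {U : Measure ℝ}

theorem integrable_exp_neg (hU : HasLaplaceTransform U) :
    Integrable (fun x => Real.exp (-x)) U := by
  simpa using hU.integrable_exp 1 one_pos

theorem integrable_exp_neg_mul_eval (hU : HasLaplaceTransform U) (p : Polynomial ℝ) :
    Integrable (fun x => Real.exp (-x) * p.eval (Real.exp (-x))) U := by
  simp_rw [exp_neg_mul_eval_eq_sum]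
  exact integrable_finsetSum _ fun i _ => (hU.integrable_exp _ (by positivity)).const_mul _

theorem integral_exp_neg_mul_eval (hU : HasLaplaceTransform U) (p : Polynomial ℝ) :
    ∫ x, Real.exp (-x) * p.eval (Real.exp (-x)) ∂U = ∑ i ∈ Finset.range (p.natDegree + 1),
      p.coeff i * ∫ x, Real.exp (-((i : ℝ) + 1) * x) ∂U := by
  simp_rw [exp_neg_mul_eval_eq_sum]
  rw [integral_finsetSum _ fun i _ => (hU.integrable_exp _ (by positivity)).const_mul _]
  simp_rw [integral_const_mul]

theorem integrable_of_continuous (hU : HasLaplaceTransform U) {w : ℝ → ℝ} (hw : Continuous w)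
    {R : ℝ} (hwR : ∀ x, R ≤ x → w x = 0) : Integrable w U := by
  obtain ⟨p, hp⟩ := exists_polynomial_near_exp_neg hw hwR one_pos
  refine ((hU.integrable_exp_neg_mul_eval p).norm.add hU.integrable_exp_neg).mono'
    hw.aestronglyMeasurable ?_
  filter_upwards [hU.ae_nonneg] with x hx
  have hx_near := (abs_sub_abs_le_abs_sub _ _).trans (hp x hx)
  rwa [one_mul, sub_le_iff_le_add'] at hx_near

theorem abs_integral_sub_integral_le (hU : HasLaplaceTransform U) {w : ℝ → ℝ}
    (hw : Integrable w U) {η : ℝ} {p : Polynomial ℝ}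
    (hp : ∀ x, 0 ≤ x → |w x - Real.exp (-x) * p.eval (Real.exp (-x))| ≤ η * Real.exp (-x)) :
    |∫ x, w x ∂U - ∫ x, Real.exp (-x) * p.eval (Real.exp (-x)) ∂U| ≤
      η * ∫ x, Real.exp (-x) ∂U := by
  rw [← integral_sub hw (hU.integrable_exp_neg_mul_eval p), ← integral_const_mul,
    ← Real.norm_eq_abs]
  exact norm_integral_le_of_norm_le (hU.integrable_exp_neg.const_mul η) (hU.ae_nonneg.mono hp)

theorem integrable_indicator_Iic (hU : HasLaplaceTransform U) (b : ℝ) :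
    Integrable ((Iic b).indicator (1 : ℝ → ℝ)) U := by
  refine (integrable_indicator_iff measurableSet_Iic).2 (integrableOn_const (ne_of_lt ?_))
  refine (measure_mono fun x hx => ?_).trans_lt
    (hU.integrable_exp_neg.measure_ge_lt_top (Real.exp_pos (-b)))
  exact Real.exp_le_exp.2 (neg_le_neg hx)

theorem measureReal_Iic_le_integral (hU : HasLaplaceTransform U) {w : ℝ → ℝ} {a : ℝ}
    (hw : Integrable w U) (haw : ∀ x, (Iic a).indicator 1 x ≤ w x) :
    U.real (Iic a) ≤ ∫ x, w x ∂U := by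
  rw [← integral_indicator_one measurableSet_Iic]
  exact integral_mono (hU.integrable_indicator_Iic a) hw haw

theorem integral_le_measureReal_Iic (hU : HasLaplaceTransform U) {w : ℝ → ℝ} {b : ℝ}
    (hw : Integrable w U) (hwb : ∀ x, w x ≤ (Iic b).indicator 1 x) :
    ∫ x, w x ∂U ≤ U.real (Iic b) := by
  rw [← integral_indicator_one measurableSet_Iic]
  exact integral_mono hw (hU.integrable_indicator_Iic b) hwb

end HasLaplaceTransform

theorem exists_continuous_between_indicator_Iic {a b : ℝ} (hab : a < b) :
    ∃ w : C(ℝ, ℝ), (∀ x, b ≤ x → w x = 0) ∧ (∀ x, (Iic a).indicator 1 x ≤ w x) ∧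
      ∀ x, w x ≤ (Iic b).indicator 1 x := by
  obtain ⟨w, hw₀, hw₁, hw⟩ := exists_continuous_zero_one_of_isClosed isClosed_Ici isClosed_Iic
    (Ici_disjoint_Iic.2 (not_le.2 hab))
  exact ⟨w, hw₀,
    indicator_le' (fun x hx => (hw₁ hx).ge) fun x _ => (hw x).1,
    le_indicator (fun x _ => (hw x).2) fun x hx => (hw₀ (mem_Ici.2 (not_le.1 hx).le)).le⟩

variable {ι : Type*} {l : Filter ι} {V : ι → Measure ℝ} {U : Measure ℝ}

theorem tendsto_integral_exp_neg_mul_eval_of_tendsto_laplace (hU : HasLaplaceTransform U)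
    (hV : ∀ i, HasLaplaceTransform (V i))
    (hlim : ∀ c : ℝ, 0 < c → Tendsto (fun i => ∫ x, Real.exp (-c * x) ∂V i) l
      (𝓝 (∫ x, Real.exp (-c * x) ∂U))) (p : Polynomial ℝ) :
    Tendsto (fun i => ∫ x, Real.exp (-x) * p.eval (Real.exp (-x)) ∂V i) l
      (𝓝 (∫ x, Real.exp (-x) * p.eval (Real.exp (-x)) ∂U)) := by
  rw [hU.integral_exp_neg_mul_eval]
  simp_rw [fun i => (hV i).integral_exp_neg_mul_eval p]
  exact tendsto_finsetSum _ fun j _ => (hlim _ (by positivity)).const_mul _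

theorem tendsto_integral_of_tendsto_laplace (hU : HasLaplaceTransform U)
    (hV : ∀ i, HasLaplaceTransform (V i))
    (hlim : ∀ c : ℝ, 0 < c → Tendsto (fun i => ∫ x, Real.exp (-c * x) ∂V i) l
      (𝓝 (∫ x, Real.exp (-c * x) ∂U)))
    {w : ℝ → ℝ} (hw : Continuous w) {R : ℝ} (hwR : ∀ x, R ≤ x → w x = 0) :
    Tendsto (fun i => ∫ x, w x ∂V i) l (𝓝 (∫ x, w x ∂U)) := by
  refine Metric.tendsto_nhds.2 fun ε hε => ?_
  set M := ∫ x, Real.exp (-x) ∂U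
  have : 0 ≤ M := integral_nonneg fun x => (Real.exp_pos _).le
  obtain ⟨η, hη, hηε⟩ : ∃ η > 0, η * (M + M) < ε := by
    refine ⟨ε / (M + M + 1), by positivity, ?_⟩
    rw [div_mul_eq_mul_div, div_lt_iff₀ (by positivity)]
    exact mul_lt_mul_of_pos_left (lt_add_one _) hε
  obtain ⟨p, hp⟩ := exists_polynomial_near_exp_neg hw hwR hη
  set Q := fun x => Real.exp (-x) * p.eval (Real.exp (-x))
  have happrox : ∀ {μ : Measure ℝ}, HasLaplaceTransform μ →
      |∫ x, w x ∂μ - ∫ x, Q x ∂μ| ≤ η * ∫ x, Real.exp (-x) ∂μ := fun hμ =>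
    hμ.abs_integral_sub_integral_le (hμ.integrable_of_continuous hw hwR) hp
  have hM_lim : Tendsto (fun i => ∫ x, Real.exp (-x) ∂V i) l (𝓝 M) := by
    simpa using hlim 1 one_pos
  have hQ_lim := tendsto_integral_exp_neg_mul_eval_of_tendsto_laplace hU hV hlim p
  have hbound := ((hM_lim.add_const M).const_mul η).add (hQ_lim.sub_const (∫ x, Q x ∂U)).abs
  rw [sub_self, abs_zero, add_zero] at hbound
  filter_upwards [hbound.eventually_lt_const hηε] with i hi
  rw [Real.dist_eq]
  have hU_near := happrox hU
  rw [abs_sub_comm] at hU_near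
  linarith [happrox (hV i), abs_sub_le (∫ x, w x ∂V i) (∫ x, Q x ∂V i) (∫ x, w x ∂U),
    abs_sub_le (∫ x, Q x ∂V i) (∫ x, Q x ∂U) (∫ x, w x ∂U)]

theorem exists_tendsto_between_measureReal_Iic (hU : HasLaplaceTransform U)
    (hV : ∀ i, HasLaplaceTransform (V i))
    (hlim : ∀ c : ℝ, 0 < c → Tendsto (fun i => ∫ x, Real.exp (-c * x) ∂V i) l
      (𝓝 (∫ x, Real.exp (-c * x) ∂U)))
    {a b : ℝ} (hab : a < b) :
    ∃ (I : ι → ℝ) (J : ℝ), Tendsto I l (𝓝 J) ∧ J ∈ Icc (U.real (Iic a)) (U.real (Iic b)) ∧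
      ∀ i, I i ∈ Icc ((V i).real (Iic a)) ((V i).real (Iic b)) := by
  obtain ⟨w, hw₀, haw, hwb⟩ := exists_continuous_between_indicator_Iic hab
  have hmem : ∀ {μ : Measure ℝ}, HasLaplaceTransform μ →
      ∫ x, w x ∂μ ∈ Icc (μ.real (Iic a)) (μ.real (Iic b)) := fun hμ =>
    have hw := hμ.integrable_of_continuous w.continuous hw₀
    ⟨hμ.measureReal_Iic_le_integral hw haw, hμ.integral_le_measureReal_Iic hw hwb⟩
  exact ⟨_, _, tendsto_integral_of_tendsto_laplace hU hV hlim w.continuous hw₀, hmem hU,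
    fun i => hmem (hV i)⟩

theorem tendsto_measureReal_Iic_of_tendsto_laplace (hU : HasLaplaceTransform U)
    (hV : ∀ i, HasLaplaceTransform (V i))
    (hlim : ∀ c : ℝ, 0 < c → Tendsto (fun i => ∫ x, Real.exp (-c * x) ∂V i) l
      (𝓝 (∫ x, Real.exp (-c * x) ∂U)))
    {b : ℝ} (hcont : ContinuousAt (fun x => U.real (Iic x)) b) :
    Tendsto (fun i => (V i).real (Iic b)) l (𝓝 (U.real (Iic b))) := by
  refine tendsto_order.2 ⟨fun y hy => ?_, fun y hy => ?_⟩
  · obtain ⟨a, hya, hab⟩ := (((hcont.mono_left nhdsWithin_le_nhds).eventually_const_lt hy).and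
      (self_mem_nhdsWithin (s := Iio b))).exists
    obtain ⟨I, J, hI, hJ, hIV⟩ := exists_tendsto_between_measureReal_Iic hU hV hlim hab
    filter_upwards [hI.eventually_const_lt (hya.trans_le hJ.1)] with i hi
    exact hi.trans_le (hIV i).2
  · obtain ⟨a, hay, hba⟩ := (((hcont.mono_left nhdsWithin_le_nhds).eventually_lt_const hy).and
      (self_mem_nhdsWithin (s := Ioi b))).exists
    obtain ⟨I, J, hI, hJ, hIV⟩ := exists_tendsto_between_measureReal_Iic hU hV hlim hba
    filter_upwards [hI.eventually_lt_const (hJ.2.trans_lt hay)] with i hi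
    exact (hIV i).1.trans_lt hi

end LaplaceTransform

section PowerMeasure

open Set

/-- The measure with density `x ^ (α - 1) / Γ(α)` on `(0, ∞)`, whose Laplace transform is
`c ↦ c ^ (-α)`. -/
noncomputable def powerMeasure (α : ℝ) : Measure ℝ :=
  (volume.restrict (Ioi 0)).withDensity fun x => ((x ^ (α - 1) / Real.Gamma α).toNNReal : ENNReal)

variable {α : ℝ}

theorem integral_powerMeasure (hα : 0 < α) (w : ℝ → ℝ) :
    ∫ x, w x ∂powerMeasure α = (Real.Gamma α)⁻¹ * ∫ x in Ioi 0, x ^ (α - 1) * w x := by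
  have hdensity : Measurable fun x : ℝ => (x ^ (α - 1) / Real.Gamma α).toNNReal := by fun_prop
  rw [powerMeasure, integral_withDensity_eq_integral_smul hdensity, ← integral_const_mul]
  refine setIntegral_congr_fun measurableSet_Ioi fun x (hx : 0 < x) => ?_
  have : 0 < Real.Gamma α := Real.Gamma_pos_of_pos hα
  simp only [NNReal.smul_def, smul_eq_mul]
  rw [Real.coe_toNNReal _ (by positivity)]
  ring

theorem integral_exp_powerMeasure (hα : 0 < α) {c : ℝ} (hc : 0 < c) :
    ∫ x, Real.exp (-c * x) ∂powerMeasure α = c ^ (-α) := by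
  simp_rw [integral_powerMeasure hα, neg_mul]
  rw [Real.integral_rpow_mul_exp_neg_mul_Ioi hα hc, mul_comm,
    mul_inv_cancel_right₀ (Real.Gamma_pos_of_pos hα).ne', one_div, Real.inv_rpow hc.le,
    Real.rpow_neg hc.le]

theorem hasLaplaceTransform_powerMeasure (hα : 0 < α) : HasLaplaceTransform (powerMeasure α) where
  ae_nonneg := by
    refine (withDensity_absolutelyContinuous _ _).ae_le ?_
    filter_upwards [ae_restrict_mem measurableSet_Ioi] with x hx using le_of_lt hx
  -- A non-integrable function would have integral `0`.
  integrable_exp c hc := not_imp_comm.1 integral_undef <| by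
    rw [integral_exp_powerMeasure hα hc]
    exact (Real.rpow_pos_of_pos hc _).ne'

theorem powerMeasure_real_Iic (hα : 0 < α) {b : ℝ} (hb : 0 ≤ b) :
    (powerMeasure α).real (Iic b) = b ^ α / Real.Gamma (1 + α) := by
  have hindicator : ∀ x : ℝ, x ^ (α - 1) * (Iic b).indicator 1 x =
      (Iic b).indicator (fun x => x ^ (α - 1)) x := fun x => by
    simp only [indicator_apply, Pi.one_apply, mul_ite, mul_one, mul_zero]
  rw [← integral_indicator_one measurableSet_Iic, integral_powerMeasure hα]
  simp_rw [hindicator]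
  rw [setIntegral_indicator measurableSet_Iic, Ioi_inter_Iic,
    ← intervalIntegral.integral_of_le hb, integral_rpow (Or.inl (by linarith)), sub_add_cancel,
    Real.zero_rpow hα.ne', sub_zero, add_comm 1 α, Real.Gamma_add_one hα.ne']
  field_simp

theorem continuousAt_powerMeasure_real_Iic (hα : 0 < α) {b : ℝ} (hb : 0 < b) :
    ContinuousAt (fun x => (powerMeasure α).real (Iic x)) b := by
  refine ((Real.continuousAt_rpow_const b α (Or.inl hb.ne')).div_const
    (Real.Gamma (1 + α))).congr ?_
  filter_upwards [lt_mem_nhds hb] with x hx using (powerMeasure_real_Iic hα hx.le).symm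

end PowerMeasure

section ScaledLaw

open Set

/-- The law of `a * k` on the event `k ≠ 0`, with `k` of law `μ`, multiplied by `C`. The atom at
`0` is removed because the factor `C` that makes these measures converge tends to infinity. -/
noncomputable def scaledLaw (μ : Measure ℕ) (a C : ℝ) : Measure ℝ :=
  ENNReal.ofReal C • (μ.restrict {0}ᶜ).map fun k : ℕ => a * (k : ℝ)

variable {μ : Measure ℕ} {a C : ℝ}

theorem scaledLaw_real_Iic (ha : 0 < a) (hC : 0 ≤ C) (y : ℝ) :
    (scaledLaw μ a C).real (Iic y) = C * μ.real {k : ℕ | 0 < a * (k : ℝ) ∧ a * (k : ℝ) ≤ y} := by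
  rw [scaledLaw, measureReal_ennreal_smul_apply, ENNReal.toReal_ofReal hC,
    map_measureReal_apply (measurable_of_countable _) measurableSet_Iic,
    measureReal_restrict_apply .of_discrete]
  congr 2
  ext k
  have hk : 0 < a * (k : ℝ) ↔ k ≠ 0 := by
    rw [mul_pos_iff_of_pos_left ha, Nat.cast_pos, Nat.pos_iff_ne_zero]
  simp [hk, and_comm]

variable [IsProbabilityMeasure μ]

theorem hasLaplaceTransform_scaledLaw (ha : 0 ≤ a) : HasLaplaceTransform (scaledLaw μ a C) := by
  have hnonneg : ∀ᵐ x ∂scaledLaw μ a C, 0 ≤ x := by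
    refine Measure.ae_smul_measure ?_ _
    rw [ae_map_iff (measurable_of_countable _).aemeasurable measurableSet_Ici]
    exact .of_forall fun k => by positivity
  have : IsFiniteMeasure (scaledLaw μ a C) := Measure.smul_finite _ ENNReal.ofReal_ne_top
  refine ⟨hnonneg, fun c hc => .of_bound (by fun_prop) 1 ?_⟩
  filter_upwards [hnonneg] with x hx
  rw [Real.norm_of_nonneg (Real.exp_pos _).le]
  exact (exp_neg_mul_mem_Icc hc.le hx).2

theorem integral_exp_scaledLaw (ha : 0 ≤ a) (hC : 0 ≤ C) {c : ℝ} (hc : 0 ≤ c) :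
    ∫ x, Real.exp (-c * x) ∂scaledLaw μ a C = C * (pgf μ (Real.exp (-c * a)) - pgf μ 0) := by
  rw [scaledLaw, integral_smul_measure, ENNReal.toReal_ofReal hC, smul_eq_mul,
    integral_map (measurable_of_countable _).aemeasurable (by fun_prop),
    ← integral_indicator .of_discrete, pgf, pgf, ← integral_sub (integrable_pow_of_mem_Icc
      (exp_neg_mul_mem_Icc hc ha)) (integrable_pow_of_mem_Icc (left_mem_Icc.2 zero_le_one))]
  congr 2
  funext k
  rcases eq_or_ne k 0 with rfl | hk
  · simp
  · rw [indicator_of_mem (by simpa using hk), zero_pow hk, sub_zero, ← Real.exp_nat_mul]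
    congr 1
    ring

end ScaledLaw

section Branching

open Set

variable {Ω : Type*}

theorem measurable_random_sum [MeasurableSpace Ω] {N : Ω → ℕ} (hN : Measurable N)
    {X : ℕ → Ω → ℕ} (hX : ∀ i, Measurable (X i)) :
    Measurable fun ω => ∑ i ∈ Finset.range (N ω), X i ω := by
  have h : Measurable fun q : ℕ × Ω => ∑ i ∈ Finset.range q.1, X i q.2 :=
    measurable_from_prod_countable_right fun k =>
      Finset.measurable_sum (Finset.range k) fun i _ => hX i
  exact h.comp (hN.prodMk measurable_id)

theorem measurable_branching {m : MeasurableSpace Ω} {ξ : ℕ → ℕ → Ω → ℕ} (n : ℕ)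
    (hξ : ∀ k < n, ∀ i, Measurable (ξ k i)) : Measurable (branching ξ n) := by
  induction n with
  | zero => exact measurable_const
  | succ n ih =>
    exact measurable_random_sum (ih fun k hk => hξ k (hk.trans n.lt_succ_self))
      (hξ n n.lt_succ_self)

variable [MeasurableSpace Ω] {P : Measure Ω}

theorem branching_ae_congr {ξ ξ' : ℕ → ℕ → Ω → ℕ} (h : ∀ n i, ξ n i =ᵐ[P] ξ' n i) (n : ℕ) :
    branching ξ n =ᵐ[P] branching ξ' n := by
  filter_upwards [ae_all_iff.2 fun n => ae_all_iff.2 (h n)] with ω hω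
  induction n with
  | zero => rfl
  | succ n ih =>
    simp only [branching]
    rw [ih]
    exact Finset.sum_congr rfl fun i _ => hω n i

theorem indepFun_branching {ξ : ℕ → ℕ → Ω → ℕ} (hmeas : ∀ n i, Measurable (ξ n i))
    (hind : iIndepFun (fun k : ℕ × ℕ => ξ k.1 k.2) P) (n : ℕ) :
    IndepFun (branching ξ n) (fun ω i => ξ n i ω) P := by
  set 𝓕 : ℕ × ℕ → MeasurableSpace Ω := fun k => .comap (ξ k.1 k.2) ⊤
  set past : Set (ℕ × ℕ) := {k | k.1 < n}
  set present : Set (ℕ × ℕ) := {k | k.1 = n}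
  have hdisj : Disjoint past present := disjoint_left.2 fun k (hk : k.1 < n) hk' => hk.ne hk'
  have hpast : MeasurableSpace.comap (branching ξ n) ⊤ ≤ ⨆ k ∈ past, 𝓕 k :=
    Measurable.comap_le <| measurable_branching n fun k hk i => .of_comap_le <|
      le_iSup₂_of_le (f := fun k (_ : k ∈ past) => 𝓕 k) (k, i) hk le_rfl
  have hpresent : MeasurableSpace.comap (fun ω i => ξ n i ω) MeasurableSpace.pi ≤
      ⨆ k ∈ present, 𝓕 k :=
    Measurable.comap_le <| @measurable_pi_lambda _ _ _ (_) _ _ fun i => .of_comap_le <|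
      le_iSup₂_of_le (f := fun k (_ : k ∈ present) => 𝓕 k) (n, i) rfl le_rfl
  have hindep : Indep (⨆ k ∈ past, 𝓕 k) (⨆ k ∈ present, 𝓕 k) P :=
    indep_iSup_of_disjoint (m := 𝓕) (fun k => (hmeas k.1 k.2).comap_le) hind hdisj
  rw [IndepFun_iff_Indep]
  exact indep_of_indep_of_le_left (indep_of_indep_of_le_right hindep hpresent) hpast

variable {ν : Measure ℕ}

theorem IsGaltonWatson.exists_measurable {Z : ℕ → Ω → ℕ}
    (hZ : IsGaltonWatson Z ν P) :
    ∃ ξ : ℕ → ℕ → Ω → ℕ, (∀ n i, Measurable (ξ n i)) ∧ (∀ n i, HasLaw (ξ n i) ν P) ∧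
      iIndepFun (fun k : ℕ × ℕ => ξ k.1 k.2) P ∧ ∀ n, Z n =ᵐ[P] branching ξ n := by
  obtain ⟨ξ, hlaw, hind, hZ⟩ := hZ
  have hae : ∀ n i, ξ n i =ᵐ[P] (hlaw n i).aemeasurable.mk (ξ n i) := fun n i =>
    (hlaw n i).aemeasurable.ae_eq_mk
  exact ⟨fun n i => (hlaw n i).aemeasurable.mk (ξ n i),
    fun n i => (hlaw n i).aemeasurable.measurable_mk, fun n i => (hlaw n i).congr (hae n i).symm,
    hind.congr fun k => hae k.1 k.2, fun n => (hZ n).trans (branching_ae_congr hae n)⟩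

theorem IsGaltonWatson.aemeasurable {Z : ℕ → Ω → ℕ}
    (hZ : IsGaltonWatson Z ν P) (n : ℕ) : AEMeasurable (Z n) P := by
  obtain ⟨ξ, hmeas, -, -, hZξ⟩ := hZ.exists_measurable
  exact (measurable_branching n fun k _ => hmeas k).aemeasurable.congr (hZξ n).symm

theorem integral_pow_sum {X : ℕ → Ω → ℕ} (hX : ∀ i, HasLaw (X i) ν P) (hind : iIndepFun X P)
    (s : ℝ) (k : ℕ) : ∫ ω, s ^ (∑ i ∈ Finset.range k, X i ω) ∂P = pgf ν s ^ k := by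
  have hprod := (hind.precomp Fin.val_injective).integral_fun_prod_comp
    (fun i : Fin k => (hX i).aemeasurable) (f := fun _ j => s ^ j)
    fun i => (measurable_of_countable _).aestronglyMeasurable
  have hpgf : ∀ i : Fin k, ∫ ω, s ^ X i ω ∂P = pgf ν s := fun i =>
    (hX i).integral_comp (measurable_of_countable fun j => s ^ j).aestronglyMeasurable
  simp_rw [← Finset.prod_pow_eq_pow_sum, Finset.prod_range, hprod, hpgf]
  rw [Finset.prod_const, Finset.card_univ, Fintype.card_fin]

variable [IsProbabilityMeasure P]

theorem integral_pow_random_sum {N : Ω → ℕ} {X : ℕ → Ω → ℕ} (hN : AEMeasurable N P)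
    (hX : ∀ i, HasLaw (X i) ν P) (hind : iIndepFun X P) (hNX : IndepFun N (fun ω i => X i ω) P)
    {s : ℝ} (hs : s ∈ Icc (0 : ℝ) 1) :
    ∫ ω, s ^ (∑ i ∈ Finset.range (N ω), X i ω) ∂P = ∫ ω, pgf ν s ^ N ω ∂P := by
  set Y : Ω → ℕ → ℕ := fun ω i => X i ω
  have hY : AEMeasurable Y P := aemeasurable_pi_lambda _ fun i => (hX i).aemeasurable
  have := Measure.isProbabilityMeasure_map hN
  have := Measure.isProbabilityMeasure_map hY
  set G : ℕ × (ℕ → ℕ) → ℝ := fun q => s ^ (∑ i ∈ Finset.range q.1, q.2 i)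
  have hG : Measurable G := (measurable_of_countable fun j : ℕ => s ^ j).comp <|
    measurable_random_sum measurable_fst fun i => (measurable_pi_apply i).comp measurable_snd
  have hG_int : Integrable G ((P.map N).prod (P.map Y)) := by
    refine .of_bound hG.aestronglyMeasurable 1 (.of_forall fun q => ?_)
    rw [Real.norm_of_nonneg (pow_nonneg hs.1 _)]
    exact pow_le_one₀ hs.1 hs.2
  calc ∫ ω, G (N ω, Y ω) ∂P = ∫ q, G q ∂P.map (fun ω => (N ω, Y ω)) :=
        (integral_map (hN.prodMk hY) hG.aestronglyMeasurable).symm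
    _ = ∫ k, ∫ x, G (k, x) ∂P.map Y ∂P.map N := by
        rw [(indepFun_iff_map_prod_eq_prod_map_map hN hY).1 hNX, integral_prod _ hG_int]
    _ = ∫ k, pgf ν s ^ k ∂P.map N := by
        refine integral_congr_ae (.of_forall fun k => ?_)
        have hGk : Measurable fun x => G (k, x) := hG.comp measurable_prodMk_left
        exact (integral_map hY hGk.aestronglyMeasurable).trans (integral_pow_sum hX hind s k)
    _ = ∫ ω, pgf ν s ^ N ω ∂P :=
        integral_map hN (measurable_of_countable _).aestronglyMeasurable

variable [IsProbabilityMeasure ν]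

theorem integral_pow_branching {ξ : ℕ → ℕ → Ω → ℕ} (hmeas : ∀ n i, Measurable (ξ n i))
    (hlaw : ∀ n i, HasLaw (ξ n i) ν P) (hind : iIndepFun (fun k : ℕ × ℕ => ξ k.1 k.2) P) (n : ℕ)
    {s : ℝ} (hs : s ∈ Icc (0 : ℝ) 1) : ∫ ω, s ^ branching ξ n ω ∂P = (pgf ν)^[n] s := by
  induction n generalizing s with
  | zero => simp [branching]
  | succ n ih =>
    have hrow : iIndepFun (ξ n) P :=
      hind.precomp (g := fun i : ℕ => (n, i)) (Prod.mk_right_injective n)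
    rw [Function.iterate_succ_apply, ← ih (pgf_mem_Icc hs)]
    exact integral_pow_random_sum (measurable_branching n fun k _ => hmeas k).aemeasurable
      (hlaw n) hrow (indepFun_branching hmeas hind n) hs

theorem IsGaltonWatson.pgf_map {Z : ℕ → Ω → ℕ} (hZ : IsGaltonWatson Z ν P) (n : ℕ) {s : ℝ}
    (hs : s ∈ Icc (0 : ℝ) 1) : pgf (P.map (Z n)) s = (pgf ν)^[n] s := by
  obtain ⟨ξ, hmeas, hlaw, hind, hZξ⟩ := hZ.exists_measurable
  have hbranching : Measurable (branching ξ n) := measurable_branching n fun k _ => hmeas k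
  rw [pgf, Measure.map_congr (hZξ n), integral_map hbranching.aemeasurable
    (measurable_of_countable _).aestronglyMeasurable]
  exact integral_pow_branching hmeas hlaw hind n hs

end Branching

section GaltonWatson

variable {ν : Measure ℕ} {α : ℝ} {φ : ℕ → ℝ}

theorem tendsto_iterate_pgf_exp_sub (H : IsRegularDescent (survivalMap ν) α)
    (hφ : Tendsto φ atTop atTop) (hφn : Tendsto (fun n : ℕ => φ n / n) atTop (𝓝 0))
    {c : ℝ} (hc : 0 < c) :
    Tendsto (fun n : ℕ => ((pgf ν)^[n] (Real.exp (-c * (survivalMap ν)^[⌊φ n⌋₊] 1)) -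
        (pgf ν)^[n] 0) * n / ((survivalMap ν)^[n] 1 * φ n)) atTop (𝓝 (c ^ (-α) * α⁻¹)) := by
  have hu := (tendsto_one_sub_exp_neg_mul_div c).comp
    (H.tendsto_iterate_one.comp (tendsto_nat_floor_atTop.comp hφ))
  refine (H.tendsto_iterate_one_sub_iterate hc hφ hφn hu).congr fun n => ?_
  simp only [Function.comp_apply, iterate_survivalMap, sub_self, sub_sub_sub_cancel_left,
    sub_sub_cancel]

theorem tendsto_measureReal_of_pgf_eq_iterate (H : IsRegularDescent (survivalMap ν) α)
    (hφ : Tendsto φ atTop atTop) (hφn : Tendsto (fun n : ℕ => φ n / n) atTop (𝓝 0))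
    {μ : ℕ → Measure ℕ} [∀ n, IsProbabilityMeasure (μ n)]
    (hμ : ∀ n, ∀ s ∈ Set.Icc (0 : ℝ) 1, pgf (μ n) s = (pgf ν)^[n] s) {y : ℝ} (hy : 0 < y) :
    Tendsto (fun n : ℕ => α * n / ((survivalMap ν)^[n] 1 * φ n) *
        (μ n).real {k : ℕ | 0 < (survivalMap ν)^[⌊φ n⌋₊] 1 * k ∧
          (survivalMap ν)^[⌊φ n⌋₊] 1 * k ≤ y})
      atTop (𝓝 (y ^ α / Real.Gamma (1 + α))) := by
  set e : ℕ → ℝ := fun n => (survivalMap ν)^[n] 1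
  set C : ℕ → ℝ := fun n => α * n / (e n * φ n)
  have he : ∀ n, 0 < e n := fun n => (H.iterate_one_mem_Ioc n).1
  have hα := H.index_pos
  have hC : ∀ᶠ n in atTop, 0 ≤ C n := by
    filter_upwards [hφ.eventually_ge_atTop 0] with n hn
    have := he n
    positivity
  have hlaplace : ∀ c : ℝ, 0 < c → Tendsto
      (fun n => ∫ x, Real.exp (-c * x) ∂scaledLaw (μ n) (e ⌊φ n⌋₊) (C n)) atTop
      (𝓝 (∫ x, Real.exp (-c * x) ∂powerMeasure α)) := fun c hc => by
    have hlim := (tendsto_iterate_pgf_exp_sub H hφ hφn hc).const_mul α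
    rw [mul_comm, inv_mul_cancel_right₀ hα.ne'] at hlim
    rw [integral_exp_powerMeasure hα hc]
    refine hlim.congr' ?_
    filter_upwards [hC] with n hn
    rw [integral_exp_scaledLaw (he _).le hn hc.le, hμ n _ (exp_neg_mul_mem_Icc hc.le (he _).le),
      hμ n 0 (Set.left_mem_Icc.2 zero_le_one)]
    ring
  have hlim := tendsto_measureReal_Iic_of_tendsto_laplace (hasLaplaceTransform_powerMeasure hα)
    (fun n => hasLaplaceTransform_scaledLaw (he _).le) hlaplace
    (continuousAt_powerMeasure_real_Iic hα hy)
  rw [powerMeasure_real_Iic hα hy.le] at hlim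
  exact hlim.congr' (hC.mono fun n hn => scaledLaw_real_Iic (he _) hn y)

end GaltonWatson

theorem isEquivalent_of_tendsto_mul {ι : Type*} {l : Filter ι} {c p : ι → ℝ} {K : ℝ}
    (hc : ∀ᶠ i in l, c i ≠ 0) (hK : K ≠ 0) (h : Tendsto (fun i => c i * p i) l (𝓝 K)) :
    p ~[l] fun i => (c i)⁻¹ * K := by
  have hequiv : (fun i => c i * p i) ~[l] fun _ => K := (isEquivalent_const_iff_tendsto hK).2 h
  refine ((IsEquivalent.refl (u := fun i => (c i)⁻¹)).mul hequiv).congr_left ?_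
  filter_upwards [hc] with i hi using inv_mul_cancel_left₀ hi (p i)

theorem theorem1_general {Ω : Type*} [MeasurableSpace Ω] (P : Measure Ω) [IsProbabilityMeasure P]
    (ν : Measure ℕ) [IsProbabilityMeasure ν] (Z : ℕ → Ω → ℕ) (hZ : IsGaltonWatson Z ν P)
    (α : ℝ) (hα : 0 < α) (L : ℝ → ℝ) (hL : SlowlyVaryingAtZero L)
    (hf : ∀ s ∈ Set.Icc (0 : ℝ) 1, pgf ν s = s + (1 - s) ^ (1 + α) * L (1 - s))
    (φ : ℕ → ℝ) (hφ : Tendsto φ atTop atTop)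
    (hφn : Tendsto (fun n : ℕ => φ n / n) atTop (𝓝 0)) (y : ℝ) (hy : 0 < y) :
    (fun n : ℕ => P.real {ω | 0 < (1 - (pgf ν)^[⌊φ n⌋₊] 0) * (Z n ω : ℝ) ∧
        (1 - (pgf ν)^[⌊φ n⌋₊] 0) * (Z n ω : ℝ) ≤ y})
      ~[atTop]
    (fun n : ℕ => (1 - (pgf ν)^[n] 0) / (α * n) * (y ^ α / Real.Gamma (1 + α)) * φ n) := by
  have H := isRegularDescent_survivalMap hα hL hf
  have hmeas := hZ.aemeasurable
  have : ∀ n, IsProbabilityMeasure (P.map (Z n)) := fun n =>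
    Measure.isProbabilityMeasure_map (hmeas n)
  have hlim := tendsto_measureReal_of_pgf_eq_iterate H hφ hφn (fun n s => hZ.pgf_map n) hy
  have hconst : ∀ᶠ n : ℕ in atTop, α * n / ((survivalMap ν)^[n] 1 * φ n) ≠ 0 := by
    filter_upwards [hφ.eventually_gt_atTop 0, eventually_gt_atTop 0] with n hφ_pos hn
    have := (H.iterate_one_mem_Ioc n).1
    positivity
  have hK : y ^ α / Real.Gamma (1 + α) ≠ 0 := by positivity
  have hsurvival : ∀ n, 1 - (pgf ν)^[n] 0 = (survivalMap ν)^[n] 1 := fun n => by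
    rw [iterate_survivalMap, sub_self]
  simp_rw [hsurvival]
  convert isEquivalent_of_tendsto_mul hconst hK hlim using 2 with n n
  · rw [map_measureReal_apply_of_aemeasurable (hmeas n) .of_discrete, Set.preimage_ofPred_eq]
  · rw [inv_div]
    ring

theorem theorem1 {Ω : Type*} [MeasurableSpace Ω] (P : Measure Ω) [IsProbabilityMeasure P]
    (ν : Measure ℕ) [IsProbabilityMeasure ν] (Z : ℕ → Ω → ℕ) (hZ : IsGaltonWatson Z ν P)
    (α : ℝ) (hα₀ : 0 < α) (hα₁ : α < 1) (L : ℝ → ℝ) (hL : SlowlyVaryingAtZero L)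
    (hmean_int : Integrable (fun k : ℕ => (k : ℝ)) ν) (hmean : ∫ k, (k : ℝ) ∂ν = 1)
    (hf : ∀ s ∈ Set.Icc (0 : ℝ) 1, pgf ν s = s + (1 - s) ^ (1 + α) * L (1 - s))
    (φ : ℕ → ℝ) (hφ : Tendsto φ atTop atTop)
    (hφn : Tendsto (fun n : ℕ => φ n / n) atTop (𝓝 0)) :
    (fun n : ℕ => P.real {ω | 0 < (1 - (pgf ν)^[⌊φ n⌋₊] 0) * (Z n ω : ℝ) ∧
        (1 - (pgf ν)^[⌊φ n⌋₊] 0) * (Z n ω : ℝ) ≤ 1})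
      ~[atTop]
    (fun n : ℕ => (1 - (pgf ν)^[n] 0) / (α * n) * (1 / Real.Gamma (1 + α)) * φ n) := by
  simpa only [Real.one_rpow] using
    theorem1_general P ν Z hZ α hα₀ L hL hf φ hφ hφn 1 one_pos
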